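/- Let $a,b\in\mathbb R$, let $k\ge 3$ be an odd integer, and for $x,E\in\mathbb R$ put $T(x,E)=\begin{pmatrix}E-x&-1\\1&0\end{pmatrix}$. Then there are exactly $k-1$ energies $E\in\mathbb R$ with $T(b,E)^k=\pm I$. Let $V:\{1,2,3,\dots\}\to\{a,b\}$ be such that, far enough out, the value $b$ always occurs with multiplicity a multiple of $k$: there is $N\ge 1$ such that whenever $n\ge N$, $l\ge 1$, $V(n)=V(n+l+1)=a$ and $V(n+j)=b$ for $1\le j\le l$, then $k$ divides $l$. Let $H$ be the operator on $\ell^2(\{1,2,3,\dots\})$ given by $(H\psi)(n)=\psi(n-1)+\psi(n+1)+V(n)\psi(n)$ with the Dirichlet boundary condition $\psi(0)=0$. For $p>0$ and $T>0$ let $$a(n,T)=\frac1T\int_0^\infty e^{-2t/T}\,|\langle\delta_n,e^{-itH}\delta_1\rangle|^2\,dt,\qquad \beta^-_{\delta_1}(p)=\liminf_{T\to+\infty}\frac{\log\sum_{n\ge1} n^p\,a(n,T)}{\log T}.$$ Then for every $E\in\mathbb R$ with $T(b,E)^k=\pm I$ the following hold. (a) If $|a-E|<2$, then $\beta^-_{\delta_1}(p)\ge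 p-1$ for every $p>0$. (b) If $|a-E|=2$, then $\beta^-_{\delta_1}(p)\ge\frac{p-5}{2}$ for every $p>0$. -/

import Mathlib

open scoped ENNReal

noncomputable section

namespace HalfLine

/-- The Hilbert space `ℓ²(ℕ)` of the half-line, where the sites are `1, 2, 3, …`. -/
abbrev L2 : Type := lp (fun _ : ℕ+ => ℂ) 2

/-- Extension of a sequence on `{1, 2, 3, …}` to the site `0` by the Dirichlet boundary
condition `ψ(0) = 0`. -/
def dirichletExt (ψ : ℕ+ → ℂ) (n : ℕ) : ℂ := if h : 0 < n then ψ (n.toPNat h) else 0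

/-- The difference expression `(Hψ)(n) = ψ(n-1) + ψ(n+1) + V(n) ψ(n)`, `n ≥ 1`, with
`ψ(0) = 0`. -/
def diffExpr (V : ℕ+ → ℝ) (ψ : ℕ+ → ℂ) (n : ℕ+) : ℂ :=
  dirichletExt ψ ((n : ℕ) - 1) + ψ (n + 1) + (V n : ℂ) * ψ n

theorem summable_sq {f : ℕ+ → ℂ} (hf : Memℓp f 2) : Summable fun n => ‖f n‖ ^ (2 : ℝ) := by
  simpa using (memℓp_gen_iff (p := 2) (by norm_num)).1 hf

theorem memℓp_of_summable {f : ℕ+ → ℂ} (hf : Summable fun n => ‖f n‖ ^ (2 : ℝ)) :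
    Memℓp f 2 :=
  (memℓp_gen_iff (p := 2) (by norm_num)).2 (by simpa using hf)

theorem memℓp_diffExpr {V : ℕ+ → ℝ} (hV : ∃ C, ∀ n, |V n| ≤ C) {ψ : ℕ+ → ℂ}
    (hψ : Memℓp ψ 2) : Memℓp (diffExpr V ψ) 2 := by
  have hinj : Function.Injective (fun n : ℕ+ => n + 1) := fun x y h => by simpa using h
  have h1 : Memℓp (fun n : ℕ+ => dirichletExt ψ ((n : ℕ) - 1)) 2 := by
    apply memℓp_of_summable
    rw [← hinj.summable_iff]
    · refine (summable_sq hψ).congr fun n => ?_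
      simp only [dirichletExt, Function.comp_apply, PNat.add_coe, PNat.one_coe,
        Nat.add_sub_cancel, dif_pos n.pos]
      rfl
    · intro n hn
      have : n = 1 := by
        by_contra h
        exact hn ⟨n - 1, PNat.sub_add_of_lt (lt_of_le_of_ne (one_le) (Ne.symm h))⟩
      subst this
      simp [dirichletExt]
  have h2 : Memℓp (fun n : ℕ+ => ψ (n + 1)) 2 :=
    memℓp_of_summable ((summable_sq hψ).comp_injective hinj)
  have h3 : Memℓp (fun n : ℕ+ => (V n : ℂ) * ψ n) 2 := by
    obtain ⟨C, hC⟩ := hV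
    refine memℓp_of_summable (Summable.of_nonneg_of_le (fun n => by positivity) (fun n => ?_)
      ((summable_sq hψ).mul_left (C ^ (2 : ℝ))))
    have hC0 : 0 ≤ C := (abs_nonneg _).trans (hC n)
    rw [← Real.mul_rpow hC0 (norm_nonneg _), norm_mul, Complex.norm_real, Real.norm_eq_abs]
    have := hC n
    gcongr
  exact (h1.add h2).add h3

theorem diffExpr_add (V : ℕ+ → ℝ) (φ ψ : ℕ+ → ℂ) :
    diffExpr V (φ + ψ) = diffExpr V φ + diffExpr V ψ := by
  funext n
  simp only [diffExpr, dirichletExt, Pi.add_apply]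
  split <;> ring

theorem diffExpr_smul (V : ℕ+ → ℝ) (c : ℂ) (ψ : ℕ+ → ℂ) :
    diffExpr V (c • ψ) = c • diffExpr V ψ := by
  funext n
  simp only [diffExpr, dirichletExt, Pi.smul_apply, smul_eq_mul]
  split <;> ring

/-- The difference expression as a linear map on `ℓ²(ℕ)`, for a bounded potential. -/
def hamiltonianLin (V : ℕ+ → ℝ) (hV : ∃ C, ∀ n, |V n| ≤ C) : L2 →ₗ[ℂ] L2 where
  toFun ψ := ⟨diffExpr V (fun n => ψ n), memℓp_diffExpr hV (lp.memℓp ψ)⟩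
  map_add' φ ψ := Subtype.ext (diffExpr_add V (fun n => φ n) (fun n => ψ n))
  map_smul' c ψ := Subtype.ext (diffExpr_smul V c (fun n => ψ n))

/-- The half-line Schrödinger operator `H` with Dirichlet boundary condition and bounded real
potential `V`, as a bounded operator on `ℓ²(ℕ)`; continuity holds by the closed graph theorem. -/
def hamiltonian (V : ℕ+ → ℝ) (hV : ∃ C, ∀ n, |V n| ≤ C) : L2 →L[ℂ] L2 :=
  ContinuousLinearMap.ofSeqClosedGraph (g := hamiltonianLin V hV) (by
    intro u x y hu hy
    have hc : ∀ (n : ℕ+) {w : ℕ → L2} {z : L2}, Filter.Tendsto w Filter.atTop (nhds z) →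
        Filter.Tendsto (fun i => w i n) Filter.atTop (nhds (z n)) := fun n w z hw =>
      ((lp.uniformContinuous_coe.continuous.tendsto z).comp hw).apply_nhds n
    ext n
    refine tendsto_nhds_unique (hc n hy) ?_
    change Filter.Tendsto (fun i => diffExpr V (fun m => u i m) n) Filter.atTop
      (nhds (diffExpr V (fun m => x m) n))
    simp only [diffExpr, dirichletExt]
    refine (Filter.Tendsto.add ?_ (hc _ hu)).add ((hc _ hu).const_mul _)
    split
    · exact hc _ hu
    · exact tendsto_const_nhds)

theorem hamiltonian_apply (V : ℕ+ → ℝ) (hV : ∃ C, ∀ n, |V n| ≤ C) (ψ : L2) (n : ℕ+) :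
    hamiltonian V hV ψ n =
      dirichletExt (fun m => ψ m) ((n : ℕ) - 1) + ψ (n + 1) + (V n : ℂ) * ψ n := rfl

theorem bounded_of_two_values {V : ℕ+ → ℝ} {a b : ℝ} (hV : ∀ n, V n = a ∨ V n = b) :
    ∃ C, ∀ n, |V n| ≤ C :=
  ⟨max |a| |b|, fun n => by rcases hV n with h | h <;> simp [h]⟩

/-- The state `δ_n`. -/
def delta (n : ℕ+) : L2 := lp.single 2 n (1 : ℂ)

/-- The evolution `ψ(t) = exp(-itH) ψ`. -/
def evolve (H : L2 →L[ℂ] L2) (ψ : L2) (t : ℝ) : L2 :=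
  NormedSpace.exp ((-(Complex.I * (t : ℂ))) • H) ψ

/-- The time-averaged probability
`a(n,T) = (1/T) ∫₀^∞ e^{-2t/T} |⟨δ_n, ψ(t)⟩|² dt`. -/
def avgProb (H : L2 →L[ℂ] L2) (ψ : L2) (n : ℕ+) (T : ℝ) : ℝ≥0∞ :=
  ENNReal.ofReal (1 / T) * ∫⁻ t in Set.Ioi (0 : ℝ),
    ENNReal.ofReal (Real.exp (-2 * t / T) * ‖inner ℂ (delta n) (evolve H ψ t)‖ ^ 2)

/-- The time-averaged moment `⟨|X|_ψ^p⟩(T) = ∑_n n^p a(n,T)`. -/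
def moment (H : L2 →L[ℂ] L2) (ψ : L2) (p T : ℝ) : ℝ≥0∞ :=
  ∑' n : ℕ+, ENNReal.ofReal ((n : ℝ) ^ p) * avgProb H ψ n T

/-- The lower growth exponent
`β⁻_ψ(p) = liminf_{T → ∞} log ⟨|X|_ψ^p⟩(T) / log T`. -/
def lowerExponent (H : L2 →L[ℂ] L2) (ψ : L2) (p : ℝ) : EReal :=
  Filter.liminf (fun T : ℝ => ENNReal.log (moment H ψ p T) / ((Real.log T : ℝ) : EReal))
    Filter.atTop

/-- The one-step transfer matrix `T(x;E)`. -/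
def transferMatrix (x E : ℝ) : Matrix (Fin 2) (Fin 2) ℝ := !![E - x, -1; 1, 0]

/-- Far enough out, the value `b` occurs with multiplicities divisible by `k`: there is `N` such
that whenever `n ≥ N`, `V(n) = V(n+l+1) = a` and `V(n+j) = b` for `1 ≤ j ≤ l`, then `k` divides
`l`. -/
def RunsDivisible (V : ℕ+ → ℝ) (a b : ℝ) (k : ℕ) : Prop :=
  ∃ N : ℕ+, ∀ n ≥ N, ∀ l : ℕ+, V n = a → V (n + l + 1) = a →
    (∀ j : ℕ+, j ≤ l → V (n + j) = b) → k ∣ (l : ℕ)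

/-- The energies `E` with `T(b;E)^k = ± I`. -/
def goodEnergies (b : ℝ) (k : ℕ) : Set ℝ :=
  {E : ℝ | transferMatrix b E ^ k = 1 ∨ transferMatrix b E ^ k = -1}

end HalfLine

end

/-! ### The energies with `T(b,E)^k = ±I` -/

namespace HalfLine

open Real

/-! If `T(b,E)^k = ±I`, every complete run of `b` between two letters `a` far out acts as a sign.
The product of transfer matrices over a far-out stretch of length `l` is therefore `±T(b)^q T(a)^s
T(b)^r` with `s ≤ l` (`exists_orderedProd_eq`). Powers of `T(b)` are bounded, being periodic up to
sign; powers of `T(a)` are bounded if `|a - E| < 2` and grow at most linearly if `|a - E| = 2`. So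
products are `O((1+l)^α)` with `α = 0` or `α = 1`.

One such energy suffices. A discrete Gronwall argument carries the bound over to complex `z` with
`|z - E| ≲ X^{-(1+α)}` and lengths up to order `X`. The Green function at `z = E + 2i/T` solves the
recursion with modulus `1` at site `0`, so with `X = T^{1/(1+α)}` its squared modulus, summed over
two neighbouring sites, is `≳ X^{-2α}` at distance of order `X` (`exists_le_norm_sq_add_norm_sq`).
It is a Laplace transform of the evolution, whence `a(n,T) ≥ (2/T²)|G(n)|²` by Cauchy–Schwarz
(`laplace_sq_le_avgProb`). Summing over about `X` sites gives a moment `≳ X^p T^{-2} X^{1-2α} =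
T^{(p-1-4α)/(1+α)}`.

The count of energies comes from the Chebyshev form of the powers: with `E - b = 2cos θ` the
condition is `sin(kθ) = 0`, that is `θ = jπ/k` with `0 < j < k`. -/

theorem transferMatrix_pow_succ_zero_zero (x E : ℝ) (n : ℕ) :
    (transferMatrix x E ^ (n + 1)) 0 0 =
      (E - x) * (transferMatrix x E ^ n) 0 0 - (transferMatrix x E ^ n) 1 0 := by
  rw [pow_succ', Matrix.mul_apply, Fin.sum_univ_two]
  simp [transferMatrix, sub_eq_add_neg]

theorem transferMatrix_pow_succ_one (x E : ℝ) (n : ℕ) (i : Fin 2) :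
    (transferMatrix x E ^ (n + 1)) 1 i = (transferMatrix x E ^ n) 0 i := by
  rw [pow_succ', Matrix.mul_apply, Fin.sum_univ_two]
  simp [transferMatrix]

/-- Outside the spectrum of the free operator the first column of the powers grows. -/
theorem abs_transferMatrix_pow_lt {x E : ℝ} (h : 2 ≤ |E - x|) (n : ℕ) :
    |(transferMatrix x E ^ n) 1 0| < |(transferMatrix x E ^ n) 0 0| := by
  induction n with
  | zero => simp
  | succ n ih =>
    rw [transferMatrix_pow_succ_zero_zero, transferMatrix_pow_succ_one]
    have h1 := abs_sub_abs_le_abs_sub ((E - x) * (transferMatrix x E ^ n) 0 0)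
      ((transferMatrix x E ^ n) 1 0)
    rw [abs_mul] at h1
    nlinarith [abs_nonneg ((transferMatrix x E ^ n) 0 0)]

/-- The lower left entry of `T^k = ±I` is zero, but it equals the upper left entry of `T^(k-1)`,
which cannot vanish when `|E - b| ≥ 2`. -/
theorem abs_lt_two_of_mem_goodEnergies {b E : ℝ} {k : ℕ} (hk : 0 < k)
    (hE : E ∈ goodEnergies b k) : |E - b| < 2 := by
  by_contra! h
  obtain ⟨m, rfl⟩ := Nat.exists_eq_succ_of_ne_zero hk.ne'
  have h1 : (transferMatrix b E ^ (m + 1)) 1 0 = 0 := by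
    rcases hE with hE | hE <;> simp [hE]
  rw [transferMatrix_pow_succ_one] at h1
  have h2 := abs_transferMatrix_pow_lt h m
  rw [h1, abs_zero] at h2
  exact absurd h2 (abs_nonneg _).not_gt

/-- The powers of an elliptic transfer matrix are Chebyshev polynomials of the second kind. -/
theorem sin_smul_transferMatrix_pow {x E θ : ℝ} (h : E - x = 2 * cos θ) (n : ℕ) :
    sin θ • transferMatrix x E ^ n =
      !![sin ((n + 1) * θ), -sin (n * θ); sin (n * θ), -sin ((n - 1) * θ)] := by
  induction n with
  | zero => ext i j; fin_cases i <;> fin_cases j <;> simp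
  | succ n ih =>
    rw [pow_succ', ← mul_smul_comm, ih, transferMatrix, h]
    have key : ∀ y : ℝ, 2 * cos θ * sin y - sin (y - θ) = sin (y + θ) := fun y => by
      rw [sin_sub, sin_add]; ring
    have h1 := key ((n + 1) * θ)
    have h2 := key (n * θ)
    rw [show ((n : ℝ) + 1) * θ - θ = n * θ by ring,
      show ((n : ℝ) + 1) * θ + θ = (n + 1 + 1) * θ by ring] at h1
    rw [show (n : ℝ) * θ - θ = (n - 1) * θ by ring,
      show (n : ℝ) * θ + θ = (n + 1) * θ by ring] at h2
    ext i j
    fin_cases i <;> fin_cases j <;>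
      simp [Matrix.mul_apply, Fin.sum_univ_two] <;> linarith

/-- Once `sin(kθ) = 0`, the addition formulas collapse the Chebyshev form to `cos(kθ) • 1`, and the
cosine is `±1`. -/
theorem mem_goodEnergies_iff {b E θ : ℝ} (h : E - b = 2 * cos θ) (hθ : sin θ ≠ 0) (k : ℕ) :
    E ∈ goodEnergies b k ↔ sin (k * θ) = 0 := by
  have hp := sin_smul_transferMatrix_pow h k
  constructor
  · intro hE
    have h1 := congrFun (congrFun hp 1) 0
    rcases hE with hE | hE <;> simpa [hE] using h1.symm
  · intro hs
    have hsum : sin ((k + 1) * θ) = cos (k * θ) * sin θ := by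
      rw [add_mul, one_mul, sin_add, hs]; ring
    have hdiff : -sin ((k - 1) * θ) = cos (k * θ) * sin θ := by
      rw [sub_mul, one_mul, sin_sub, hs]; ring
    have hT : transferMatrix b E ^ k = cos (k * θ) • 1 := by
      refine smul_right_injective _ hθ ?_
      simp only [hp]
      rw [hsum, hdiff, hs]
      ext i j
      fin_cases i <;> fin_cases j <;> simp [mul_comm]
    rcases sin_eq_zero_iff_cos_eq.1 hs with hc | hc
    · left; rw [hT, hc, one_smul]
    · right; rw [hT, hc, neg_one_smul]

theorem goodEnergies_eq_image {b : ℝ} {k : ℕ} (hk : 0 < k) :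
    goodEnergies b k =
      (fun j : ℕ => b + 2 * cos (j * π / k)) '' (Finset.Ioo 0 k : Finset ℕ) := by
  have hk' : (0 : ℝ) < k := by exact_mod_cast hk
  ext E
  constructor
  · intro hE
    have h2 := abs_lt.1 (abs_lt_two_of_mem_goodEnergies hk hE)
    set θ := arccos ((E - b) / 2) with hθ
    have hc : E - b = 2 * cos θ := by
      rw [hθ, cos_arccos (by linarith [h2.1]) (by linarith [h2.2])]; ring
    have h0 : 0 < θ := arccos_pos.2 (by linarith [h2.2])
    have hπ : θ < π := by
      refine lt_of_le_of_ne (arccos_le_pi _) fun h => ?_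
      rw [h, cos_pi] at hc
      linarith [h2.1]
    have hs := (mem_goodEnergies_iff hc (sin_pos_of_pos_of_lt_pi h0 hπ).ne' k).1 hE
    obtain ⟨j, hj⟩ := sin_eq_zero_iff.1 hs
    have hj0 : 0 < j := by
      have : (0 : ℝ) < j * π := by rw [hj]; positivity
      exact_mod_cast pos_of_mul_pos_left this pi_pos.le
    have hjk : j < k := by
      have : (j : ℝ) * π < k * π := by rw [hj]; gcongr
      exact_mod_cast lt_of_mul_lt_mul_right this pi_pos.le
    lift j to ℕ using hj0.le
    refine ⟨j, by simpa using ⟨by exact_mod_cast hj0, by exact_mod_cast hjk⟩, ?_⟩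
    have : (j : ℝ) * π / k = θ := by
      rw [div_eq_iff hk'.ne', mul_comm θ]; exact_mod_cast hj
    simp only [this]
    linarith
  · rintro ⟨j, hj, rfl⟩
    obtain ⟨hj0, hjk⟩ : 0 < j ∧ j < k := by simpa using hj
    have hj0' : (0 : ℝ) < j := by exact_mod_cast hj0
    have hjk' : (j : ℝ) < k := by exact_mod_cast hjk
    refine (mem_goodEnergies_iff (θ := j * π / k) (by ring) ?_ k).2 ?_
    · refine (sin_pos_of_pos_of_lt_pi (by positivity) ?_).ne'
      rw [div_lt_iff₀ hk', mul_comm π]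
      gcongr
    · rw [mul_div_cancel₀ _ hk'.ne']
      exact sin_nat_mul_pi j

theorem ncard_goodEnergies {b : ℝ} {k : ℕ} (hk : 0 < k) : (goodEnergies b k).ncard = k - 1 := by
  have hk' : (0 : ℝ) < k := by exact_mod_cast hk
  rw [goodEnergies_eq_image hk, Set.InjOn.ncard_image, Set.ncard_coe_finset, Nat.card_Ioo,
    Nat.sub_zero]
  have hmem : ∀ i ∈ ((Finset.Ioo 0 k : Finset ℕ) : Set ℕ), (i : ℝ) * π / k ∈ Set.Icc 0 π := by
    intro i hi
    have : (i : ℝ) ≤ k := by exact_mod_cast (Finset.mem_Ioo.1 hi).2.le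
    refine ⟨by positivity, ?_⟩
    rw [div_le_iff₀ hk', mul_comm π]
    gcongr
  intro i hi j hj hij
  have h := injOn_cos (hmem i hi) (hmem j hj) (by simpa using hij)
  rw [div_left_inj' hk'.ne'] at h
  exact_mod_cast mul_right_cancel₀ pi_ne_zero h

end HalfLine
-- Products of matrices along a two-letter sequence
namespace HalfLine

/-- The product `f m * f (m + 1) * ⋯ * f (m + l - 1)`. -/
def orderedProd {R : Type*} [Monoid R] (f : ℕ → R) (m : ℕ) : ℕ → R
  | 0 => 1
  | l + 1 => orderedProd f m l * f (m + l)

section Ring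

variable {R : Type*} [Ring R]

/-- Discrete Duhamel formula: terms are sorted by the last position `j` where `d` is chosen. The
perturbed products on the right are shorter than `l`, as a Gronwall argument needs. -/
theorem orderedProd_add_eq_sum (f d : ℕ → R) (m l : ℕ) :
    orderedProd (f + d) m l = orderedProd f m l +
      ∑ j ∈ Finset.range l,
        orderedProd (f + d) m j * d (m + j) * orderedProd f (m + j + 1) (l - (j + 1)) := by
  induction l with
  | zero => simp [orderedProd]
  | succ l ih =>
    have hsum : ∑ j ∈ Finset.range l,
          orderedProd (f + d) m j * d (m + j) * orderedProd f (m + j + 1) (l + 1 - (j + 1)) =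
        (∑ j ∈ Finset.range l,
          orderedProd (f + d) m j * d (m + j) * orderedProd f (m + j + 1) (l - (j + 1))) *
            f (m + l) := by
      rw [Finset.sum_mul]
      refine Finset.sum_congr rfl fun j hj => ?_
      have hj := Finset.mem_range.1 hj
      rw [show l + 1 - (j + 1) = l - (j + 1) + 1 by omega, orderedProd, ← mul_assoc,
        show m + j + 1 + (l - (j + 1)) = m + l by omega]
    rw [Finset.sum_range_succ, hsum, orderedProd, Pi.add_apply, mul_add]
    nth_rewrite 1 [ih]
    rw [add_mul, orderedProd, Nat.sub_self, orderedProd, mul_one, add_assoc]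

theorem pow_eq_one_or_neg_one_of_dvd {B : R} {k r : ℕ} (hB : B ^ k = 1 ∨ B ^ k = -1)
    (h : k ∣ r) : B ^ r = 1 ∨ B ^ r = -1 := by
  obtain ⟨c, rfl⟩ := h
  rw [pow_mul]
  rcases hB with hB | hB
  · simp [hB]
  · rw [hB]; exact neg_one_pow_eq_or R c

/-- If the letter `b` occurs between two letters `a` only with multiplicities `r` for which
`T b ^ r = ±1`, then every product collapses to one run of `b`, one of `a`, and one of `b`. -/
theorem exists_orderedProd_eq {ι : Type*} {a b : ι} (T : ι → R) {W : ℕ → ι} {k N m : ℕ}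
    (hW : ∀ n, W n = a ∨ W n = b) (hB : T b ^ k = 1 ∨ T b ^ k = -1)
    (hrun : ∀ n ≥ N, ∀ l ≥ 1, W n = a → W (n + l + 1) = a →
      (∀ j, 1 ≤ j → j ≤ l → W (n + j) = b) → k ∣ l) (hm : N ≤ m) (l : ℕ) :
    ∃ (ε : R) (q s r : ℕ), (ε = 1 ∨ ε = -1) ∧ s ≤ l ∧
      orderedProd (fun n => T (W n)) m l = ε * (T b ^ q * T a ^ s * T b ^ r) := by
  -- The induction has to remember the position `i` of the last `a`, so that the trailing run of `b`
  -- is known to be complete when the next `a` arrives.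
  suffices (orderedProd (fun n => T (W n)) m l = T b ^ l) ∨
      ∃ i < l, W (m + i) = a ∧ (∀ j, i < j → j < l → W (m + j) = b) ∧
        ∃ (ε : R) (q s : ℕ), (ε = 1 ∨ ε = -1) ∧ s ≤ l ∧
          orderedProd (fun n => T (W n)) m l =
            ε * (T b ^ q * T a ^ s * T b ^ (l - 1 - i)) by
    rcases this with h | ⟨i, -, -, -, ε, q, s, hε, hs, h⟩
    · exact ⟨1, l, 0, 0, Or.inl rfl, Nat.zero_le _, by simp [h]⟩
    · exact ⟨ε, q, s, _, hε, hs, h⟩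
  induction l with
  | zero => left; simp [orderedProd]
  | succ l ih =>
    rcases hW (m + l) with hl | hl
    · right
      refine ⟨l, Nat.lt_succ_self l, hl, fun j h1 h2 => by omega, ?_⟩
      rw [show l + 1 - 1 - l = 0 by omega, pow_zero]
      simp only [mul_one, orderedProd, hl]
      rcases ih with h | ⟨i, hi, hia, hib, ε, q, s, hε, hs, h⟩
      · exact ⟨1, l, 1, Or.inl rfl, by omega, by simp [h]⟩
      · have hr : T b ^ (l - 1 - i) = 1 ∨ T b ^ (l - 1 - i) = -1 := by
          -- Adjacent letters `a` enclose an empty run, which `hrun` does not cover.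
          rcases Nat.eq_zero_or_pos (l - 1 - i) with h0 | h0
          · left; rw [h0, pow_zero]
          · refine pow_eq_one_or_neg_one_of_dvd hB
              (hrun (m + i) (by omega) _ h0 hia ?_ fun j h1 h2 => ?_)
            · rw [show m + i + (l - 1 - i) + 1 = m + l by omega]; exact hl
            · rw [add_assoc]; exact hib _ (by omega) (by omega)
        rcases hr with hr | hr
        · refine ⟨ε, q, s + 1, hε, by omega, ?_⟩
          rw [h, hr, mul_one, pow_succ]; simp only [mul_assoc]
        · refine ⟨-ε, q, s + 1, ?_, by omega, ?_⟩
          · rcases hε with rfl | rfl <;> simp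
          · rw [h, hr, pow_succ]; simp only [mul_assoc, mul_neg, neg_mul, mul_one]
    · simp only [orderedProd, hl]
      rcases ih with h | ⟨i, hi, hia, hib, ε, q, s, hε, hs, h⟩
      · left; rw [h, pow_succ]
      · right
        refine ⟨i, by omega, hia, fun j h1 h2 => ?_, ε, q, s, hε, by omega, ?_⟩
        · rcases (Nat.lt_succ_iff.1 h2).eq_or_lt with rfl | h3
          · exact hl
          · exact hib j h1 h3
        · rw [h, show l + 1 - 1 - i = l - 1 - i + 1 by omega, pow_succ]; simp only [mul_assoc]

end Ring

/-! ### Growth and stability of products -/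

section NormedRing

variable {R : Type*} [NormedRing R]

/-- Discrete Gronwall inequality: the induction runs on the majorant `K + δ * ∑ y j`, which grows by
a factor at most `1 + δ` per step. -/
theorem le_mul_one_add_pow_of_le_add_sum {y : ℕ → ℝ} {K δ : ℝ} {L : ℕ} (hδ : 0 ≤ δ)
    (h : ∀ l ≤ L, y l ≤ K + δ * ∑ j ∈ Finset.range l, y j) {l : ℕ} (hl : l ≤ L) :
    y l ≤ K * (1 + δ) ^ l := by
  refine (h l hl).trans ?_
  induction l with
  | zero => simp
  | succ l ih =>
    have h1 := ih (by omega)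
    have h2 := mul_le_mul_of_nonneg_left (h l (by omega)) hδ
    have h3 := mul_le_mul_of_nonneg_right h1 (show 0 ≤ 1 + δ by positivity)
    rw [Finset.sum_range_succ, pow_succ]
    linarith

/-- Stability of bounds on products under small perturbations of the factors. -/
theorem norm_orderedProd_add_le {f d : ℕ → R} {m L : ℕ} {K η : ℝ}
    (hf : ∀ m' ≥ m, ∀ l ≤ L, ‖orderedProd f m' l‖ ≤ K) (hd : ∀ n, ‖d n‖ ≤ η) (l : ℕ)
    (hl : l ≤ L) : ‖orderedProd (f + d) m l‖ ≤ K * (1 + K * η) ^ l := by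
  have hη : 0 ≤ η := (norm_nonneg _).trans (hd 0)
  have hK : 0 ≤ K := (norm_nonneg _).trans (hf m le_rfl 0 (Nat.zero_le _))
  refine le_mul_one_add_pow_of_le_add_sum (y := fun l => ‖orderedProd (f + d) m l‖)
    (L := L) (by positivity) (fun l hl => ?_) hl
  rw [orderedProd_add_eq_sum, Finset.mul_sum]
  refine (norm_add_le _ _).trans (add_le_add (hf m le_rfl l hl) ?_)
  refine (norm_sum_le _ _).trans (Finset.sum_le_sum fun j _ => ?_)
  calc _ ≤ ‖orderedProd (f + d) m j‖ * ‖d (m + j)‖ * ‖orderedProd f (m + j + 1) (l - (j + 1))‖ :=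
        (norm_mul_le _ _).trans (mul_le_mul_of_nonneg_right (norm_mul_le _ _) (norm_nonneg _))
    _ ≤ ‖orderedProd (f + d) m j‖ * η * K := by
        gcongr
        · exact hd _
        · exact hf _ (by omega) _ (by omega)
    _ = _ := by ring

/-- Up to sign the powers are `k`-periodic, so finitely many norms occur. -/
theorem exists_norm_pow_le {B : R} {k : ℕ} (hk : 0 < k) (hB : B ^ k = 1 ∨ B ^ k = -1) :
    ∃ C, ∀ n : ℕ, ‖B ^ n‖ ≤ C := by
  refine ⟨∑ i ∈ Finset.range k, ‖B ^ i‖, fun n => ?_⟩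
  have h : ‖B ^ n‖ = ‖B ^ (n % k)‖ := by
    conv_lhs => rw [← Nat.mod_add_div n k, pow_add]
    rcases pow_eq_one_or_neg_one_of_dvd hB (Dvd.intro (n / k) rfl) with h | h <;> simp [h]
  rw [h]
  exact Finset.single_le_sum (f := fun i => ‖B ^ i‖) (fun _ _ => norm_nonneg _)
    (Finset.mem_range.2 (Nat.mod_lt _ hk))

theorem exists_norm_orderedProd_le {ι : Type*} {a b : ι} (T : ι → R) {W : ℕ → ι} {k N : ℕ}
    {C α : ℝ} (hα : 0 ≤ α) (hk : 0 < k) (hW : ∀ n, W n = a ∨ W n = b)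
    (hB : T b ^ k = 1 ∨ T b ^ k = -1)
    (hrun : ∀ n ≥ N, ∀ l ≥ 1, W n = a → W (n + l + 1) = a →
      (∀ j, 1 ≤ j → j ≤ l → W (n + j) = b) → k ∣ l)
    (hA : ∀ s : ℕ, ‖T a ^ s‖ ≤ C * (1 + s) ^ α) :
    ∃ C' > 0, ∀ m ≥ N, ∀ l : ℕ, ‖orderedProd (fun n => T (W n)) m l‖ ≤ C' * (1 + l) ^ α := by
  obtain ⟨D, hD⟩ := exists_norm_pow_le hk hB
  have hC : 0 ≤ C := by simpa using (norm_nonneg _).trans (hA 0)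
  have hD0 : 0 ≤ D := (norm_nonneg _).trans (hD 0)
  refine ⟨D * C * D + 1, by positivity, fun m hm l => ?_⟩
  obtain ⟨ε, q, s, r, hε, hs, h⟩ := exists_orderedProd_eq T hW hB hrun hm l
  have hsl : (s : ℝ) ≤ l := by exact_mod_cast hs
  calc _ = ‖T b ^ q * T a ^ s * T b ^ r‖ := by rw [h]; rcases hε with rfl | rfl <;> simp
    _ ≤ ‖T b ^ q‖ * ‖T a ^ s‖ * ‖T b ^ r‖ :=
        (norm_mul_le _ _).trans (mul_le_mul_of_nonneg_right (norm_mul_le _ _) (norm_nonneg _))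
    _ ≤ D * (C * (1 + l) ^ α) * D := by
        gcongr
        · exact hD q
        · exact (hA s).trans (by gcongr)
        · exact hD r
    _ ≤ _ := by nlinarith [Real.rpow_nonneg (show (0 : ℝ) ≤ 1 + l by positivity) α]

end NormedRing

-- Powers of elliptic and parabolic transfer matrices

attribute [local instance] Matrix.linftyOpNormedRing Matrix.linftyOpNormedAddCommGroup
  Matrix.linftyOpNormedSpace

/-- The one-step transfer matrix at a complex energy. -/
def complexTransfer (z : ℂ) (x : ℝ) : Matrix (Fin 2) (Fin 2) ℂ := !![z - x, -1; 1, 0]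

theorem mapMatrix_transferMatrix (x E : ℝ) :
    Complex.ofRealHom.mapMatrix (transferMatrix x E) = complexTransfer E x := by
  ext i j
  fin_cases i <;> fin_cases j <;> simp [transferMatrix, complexTransfer]

theorem complexTransfer_pow_eq {b E : ℝ} {k : ℕ} (hE : E ∈ goodEnergies b k) :
    complexTransfer E b ^ k = 1 ∨ complexTransfer E b ^ k = -1 := by
  rw [← mapMatrix_transferMatrix, ← map_pow]
  rcases hE with h | h
  · left; rw [h, map_one]
  · right; rw [h, map_neg, map_one]

theorem norm_matrix_two_le {A : Matrix (Fin 2) (Fin 2) ℂ} {c : ℝ} (h : ∀ i j, ‖A i j‖ ≤ c) :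
    ‖A‖ ≤ 2 * c := by
  have hc : 0 ≤ c := (norm_nonneg _).trans (h 0 0)
  rw [Matrix.linfty_opNorm_def]
  lift c to NNReal using hc
  norm_cast
  refine Finset.sup_le fun i _ => ?_
  rw [Fin.sum_univ_two, two_mul]
  exact add_le_add (h i 0) (h i 1)

theorem norm_complexTransfer_le (z : ℂ) (x : ℝ) : ‖complexTransfer z x‖ ≤ 2 * (1 + ‖z - x‖) := by
  refine norm_matrix_two_le fun i j => ?_
  fin_cases i <;> fin_cases j <;> simp [complexTransfer]
  positivity

/-- The quadratic form preserved by an elliptic transfer matrix. -/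
theorem transferMatrix_pow_form (x E : ℝ) (n : ℕ) (i : Fin 2) :
    (transferMatrix x E ^ n) 0 i ^ 2 -
      (E - x) * (transferMatrix x E ^ n) 0 i * (transferMatrix x E ^ n) 1 i +
        (transferMatrix x E ^ n) 1 i ^ 2 = 1 := by
  induction n with
  | zero => fin_cases i <;> simp
  | succ n ih =>
    have h : (transferMatrix x E ^ (n + 1)) 0 i =
        (E - x) * (transferMatrix x E ^ n) 0 i - (transferMatrix x E ^ n) 1 i := by
      rw [pow_succ', Matrix.mul_apply, Fin.sum_univ_two]
      simp [transferMatrix, sub_eq_add_neg]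
    rw [transferMatrix_pow_succ_one, h, ← ih]
    ring

/-- For `|t| < 2` the invariant form `u² - tuv + v²` is positive definite: it dominates `(1 -
|t|/2)(u² + v²)`. Its level set therefore bounds the entries. -/
theorem exists_norm_elliptic_pow_le {a E : ℝ} (h : |a - E| < 2) :
    ∃ C, ∀ n : ℕ, ‖complexTransfer E a ^ n‖ ≤ C := by
  rw [abs_sub_comm, abs_lt] at h
  set c := 1 - |E - a| / 2 with hc
  have hc0 : 0 < c := by
    have := abs_lt.2 h
    linarith
  refine ⟨2 * √(1 / c), fun n => norm_matrix_two_le fun i j => ?_⟩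
  rw [← mapMatrix_transferMatrix, ← map_pow]
  simp only [RingHom.mapMatrix_apply, Matrix.map_apply, Complex.ofRealHom_eq_coe,
    Complex.norm_real, Real.norm_eq_abs]
  refine Real.abs_le_sqrt ?_
  rw [le_div_iff₀ hc0]
  have key : ∀ u v t : ℝ, u ^ 2 - t * u * v + v ^ 2 = 1 →
      u ^ 2 * (1 - |t| / 2) + v ^ 2 * (1 - |t| / 2) ≤ 1 := by
    intro u v t h
    rcases abs_cases t with ⟨h1, h2⟩ | ⟨h1, h2⟩ <;> rw [h1]
    · nlinarith [mul_nonneg h2 (sq_nonneg (u - v))]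
    · nlinarith [mul_nonneg (neg_pos.2 h2).le (sq_nonneg (u + v))]
  have h1 := key _ _ _ (transferMatrix_pow_form a E n j)
  rw [← hc] at h1
  fin_cases i <;>
    simp only [Fin.zero_eta, Fin.mk_one] <;>
    nlinarith [mul_nonneg (sq_nonneg ((transferMatrix a E ^ n) 0 j)) hc0.le,
      mul_nonneg (sq_nonneg ((transferMatrix a E ^ n) 1 j)) hc0.le]

/-- Up to a sign `σ` the matrix is unipotent, `1 + N` with `N² = 0`, so its powers are affine in
`n`. -/
theorem exists_norm_parabolic_pow_le {a E : ℝ} (h : |a - E| = 2) :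
    ∃ C, ∀ n : ℕ, ‖complexTransfer E a ^ n‖ ≤ C * (1 + n) := by
  obtain ⟨σ, hσ, hE⟩ : ∃ σ : ℂ, (σ = 1 ∨ σ = -1) ∧ (E : ℂ) - a = 2 * σ := by
    rcases (abs_eq zero_le_two).1 h with h | h
    · refine ⟨-1, Or.inr rfl, ?_⟩
      rw [← Complex.ofReal_sub, ← neg_sub, h]; norm_num
    · refine ⟨1, Or.inl rfl, ?_⟩
      rw [← Complex.ofReal_sub, ← neg_sub, h]; norm_num
  have hσ2 : σ * σ = 1 := by rcases hσ with rfl | rfl <;> norm_num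
  have hσn : ‖σ‖ = 1 := by rcases hσ with rfl | rfl <;> norm_num
  set N : Matrix (Fin 2) (Fin 2) ℂ := !![1, -σ; σ, -1] with hN
  have hNN : N * N = 0 := by
    ext i j
    fin_cases i <;> fin_cases j <;>
      simp [hN, Matrix.mul_apply, Fin.sum_univ_two, hσ2]
  have hT : complexTransfer E a = σ • (1 + N) := by
    ext i j
    fin_cases i <;> fin_cases j <;> simp [hN, complexTransfer, hE, hσ2]
    ring
  have hpow : ∀ n : ℕ, complexTransfer E a ^ n = σ ^ n • (1 + (n : ℂ) • N) := by
    intro n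
    induction n with
    | zero => simp
    | succ n ih =>
      rw [pow_succ, ih, hT, smul_mul_smul_comm, ← pow_succ, mul_add, mul_one, add_mul, one_mul,
        smul_mul_assoc, hNN, smul_zero, add_zero, Nat.cast_succ, add_smul, one_smul]
      abel_nf
  refine ⟨‖(1 : Matrix (Fin 2) (Fin 2) ℂ)‖ + ‖N‖, fun n => ?_⟩
  rw [hpow, norm_smul, norm_pow, hσn, one_pow, one_mul]
  refine (norm_add_le _ _).trans ?_
  rw [norm_smul, Complex.norm_natCast]
  nlinarith [norm_nonneg (1 : Matrix (Fin 2) (Fin 2) ℂ), norm_nonneg N,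
    (Nat.cast_nonneg n : (0 : ℝ) ≤ n),
    mul_nonneg (Nat.cast_nonneg n : (0 : ℝ) ≤ n) (norm_nonneg (1 : Matrix (Fin 2) (Fin 2) ℂ))]

end HalfLine
-- Lower bounds on solutions near a real energy
namespace HalfLine

attribute [local instance] Matrix.linftyOpNormedRing Matrix.linftyOpNormedAddCommGroup
  Matrix.linftyOpNormedSpace

/-- The product recovers earlier values from later ones, so an upper bound on it is directly a lower
bound on later values, with no inverse needed. -/
theorem eq_orderedProd_mulVec {z : ℂ} {W : ℕ → ℝ} {g : ℕ → ℂ}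
    (hg : ∀ n, g n = (z - W n) * g (n + 1) - g (n + 2)) (m l : ℕ) :
    ![g m, g (m + 1)] =
      (orderedProd (fun n => complexTransfer z (W n)) m l).mulVec
        ![g (m + l), g (m + l + 1)] := by
  induction l with
  | zero => simp [orderedProd]
  | succ l ih =>
    have hstep : ![g (m + l), g (m + l + 1)] =
        (complexTransfer z (W (m + l))).mulVec ![g (m + l + 1), g (m + l + 1 + 1)] := by
      ext i
      fin_cases i
      · simp [complexTransfer, Matrix.mulVec, dotProduct, hg (m + l), sub_eq_add_neg]
      · simp [complexTransfer, Matrix.mulVec, dotProduct]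
    rw [ih, hstep, Matrix.mulVec_mulVec]
    rfl

theorem norm_orderedProd_le_pow {R : Type*} [NormedRing R] [NormOneClass R] {f : ℕ → R} {S : ℝ}
    (hf : ∀ n, ‖f n‖ ≤ S) (m l : ℕ) : ‖orderedProd f m l‖ ≤ S ^ l := by
  induction l with
  | zero => simp [orderedProd]
  | succ l ih =>
    have hS : 0 ≤ S := (norm_nonneg _).trans (hf 0)
    rw [pow_succ]
    exact (norm_mul_le _ _).trans (mul_le_mul ih (hf _) (norm_nonneg _) (by positivity))

/-- Power-law bounds on transfer matrices at a real energy `E` bound solutions from below at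
complex energies near `E`, on the scale of the distance to `E`. -/
theorem exists_le_norm_sq_add_norm_sq {E B C α : ℝ} {W : ℕ → ℝ} {N : ℕ} (hα : 0 ≤ α)
    (hW : ∀ n, |W n| ≤ B) (hC : 0 < C)
    (hprod : ∀ m ≥ N, ∀ l : ℕ,
      ‖orderedProd (fun n => complexTransfer E (W n)) m l‖ ≤ C * (1 + l) ^ α) :
    ∃ c > 0, ∀ X : ℝ, 1 ≤ X → ∀ z : ℂ, ‖z - E‖ ≤ 2 * X ^ (-(1 + α)) → ∀ g : ℕ → ℂ,
      ‖g 0‖ = 1 → (∀ n, g n = (z - W n) * g (n + 1) - g (n + 2)) →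
      ∀ n : ℕ, N ≤ n → (n : ℝ) ≤ 5 * X →
        c * X ^ (-(2 * α)) ≤ ‖g n‖ ^ 2 + ‖g (n + 1)‖ ^ 2 := by
  have hB : 0 ≤ B := (abs_nonneg _).trans (hW 0)
  -- `S` bounds one step when `‖z - E‖ ≤ 2`, and pays for the first `N` sites. Since `1 + l ≤ 6X`,
  -- unperturbed products are at most `K = C(6X)^α`. Each perturbation has norm at most `η =
  -- 4X^{-(1+α)}`, and `l ≤ 5X` gives `l * K * η ≤ Q`.
  set S : ℝ := 2 * (1 + (2 + |E| + B)) with hS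
  have hS0 : 0 < S := by positivity
  set Q : ℝ := 20 * 6 ^ α * C with hQ
  set D : ℝ := S ^ N * (C * 6 ^ α * Real.exp Q) with hD
  have hD0 : 0 < D := by positivity
  refine ⟨(1 / D) ^ 2, by positivity, fun X hX z hz g hg0 hg n hNn hn => ?_⟩
  have hX0 : 0 < X := by linarith
  obtain ⟨l, rfl⟩ := Nat.exists_eq_add_of_le hNn
  have hl5 : (l : ℝ) ≤ 5 * X := by push_cast at hn; linarith [(Nat.cast_nonneg N : (0 : ℝ) ≤ N)]
  have hz2 : ‖z - E‖ ≤ 2 := by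
    refine hz.trans ?_
    have := Real.rpow_le_one_of_one_le_of_nonpos hX (show -(1 + α) ≤ 0 by linarith)
    linarith
  have hfirst : ‖orderedProd (fun n => complexTransfer z (W n)) 0 N‖ ≤ S ^ N := by
    refine norm_orderedProd_le_pow (fun j => (norm_complexTransfer_le _ _).trans ?_) 0 N
    have h1 : ‖z - W j‖ ≤ ‖z - E‖ + ‖(E : ℂ)‖ + ‖(W j : ℂ)‖ := by
      calc ‖z - W j‖ = ‖(z - E) + E - W j‖ := by congr 1; ring
        _ ≤ ‖(z - E) + E‖ + ‖(W j : ℂ)‖ := norm_sub_le _ _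
        _ ≤ _ := by gcongr; exact norm_add_le _ _
    rw [Complex.norm_real, Complex.norm_real, Real.norm_eq_abs, Real.norm_eq_abs] at h1
    have := hW j
    rw [hS]
    linarith
  have hsecond : ‖orderedProd (fun n => complexTransfer z (W n)) N l‖ ≤
      C * 6 ^ α * Real.exp Q * X ^ α := by
    set K : ℝ := C * (6 * X) ^ α with hK
    set η : ℝ := 4 * X ^ (-(1 + α)) with hη
    have hK0 : 0 ≤ K := by positivity
    have hη0 : 0 ≤ η := by positivity
    have hsplit : (fun n => complexTransfer z (W n)) =
        (fun n => complexTransfer E (W n)) + fun _ => !![z - E, 0; 0, 0] := by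
      funext j
      ext i i'
      fin_cases i <;> fin_cases i' <;> simp [complexTransfer]
    have h := norm_orderedProd_add_le (f := fun n => complexTransfer E (W n))
      (d := fun _ => !![z - E, 0; 0, 0]) (m := N) (L := l) (K := K) (η := η)
      (fun m' hm' l' hl' => (hprod m' hm' l').trans ?_) (fun _ => ?_) l le_rfl
    · rw [← hsplit] at h
      refine h.trans ?_
      have h1 : (1 + K * η) ^ l ≤ Real.exp Q := by
        have h2 : 1 + K * η ≤ Real.exp (K * η) := by
          linarith [Real.add_one_le_exp (K * η)]
        refine (pow_le_pow_left₀ (by positivity) h2 l).trans ?_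
        rw [← Real.exp_nat_mul, Real.exp_le_exp]
        have h3 : K * η = 4 * C * 6 ^ α * X⁻¹ := by
          rw [hK, hη, Real.mul_rpow (by norm_num) hX0.le, neg_add, Real.rpow_add hX0,
            Real.rpow_neg hX0.le α, Real.rpow_neg_one]
          have : X ^ α ≠ 0 := (Real.rpow_pos_of_pos hX0 α).ne'
          field_simp
        rw [h3, hQ]
        calc (l : ℝ) * (4 * C * 6 ^ α * X⁻¹) ≤ (5 * X) * (4 * C * 6 ^ α * X⁻¹) := by gcongr
          _ = _ := by field_simp; ring
      calc K * (1 + K * η) ^ l ≤ K * Real.exp Q := by gcongr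
        _ = _ := by rw [hK, Real.mul_rpow (by norm_num) hX0.le]; ring
    · have : (l' : ℝ) ≤ l := by exact_mod_cast hl'
      rw [hK]
      gcongr
      linarith
    · refine (norm_matrix_two_le (c := ‖z - E‖) fun i i' => ?_).trans (by rw [hη]; linarith)
      fin_cases i <;> fin_cases i' <;> simp
  set u : Fin 2 → ℂ := ![g (N + l), g (N + l + 1)] with hu
  have hlow : 1 ≤ D * X ^ α * ‖u‖ := by
    calc (1 : ℝ) = ‖![g 0, g (0 + 1)] 0‖ := by simp [hg0]
      _ ≤ ‖![g 0, g (0 + 1)]‖ := norm_le_pi_norm _ _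
      _ ≤ S ^ N * ((C * 6 ^ α * Real.exp Q * X ^ α) * ‖u‖) := by
          rw [eq_orderedProd_mulVec hg 0 N]
          refine (Matrix.linfty_opNorm_mulVec _ _).trans ?_
          gcongr
          rw [zero_add, eq_orderedProd_mulVec hg N l]
          refine (Matrix.linfty_opNorm_mulVec _ _).trans ?_
          gcongr
      _ = _ := by rw [hD]; ring
  have hu2 : ‖u‖ ^ 2 ≤ ‖g (N + l)‖ ^ 2 + ‖g (N + l + 1)‖ ^ 2 := by
    have h : ‖u‖ ≤ √(‖g (N + l)‖ ^ 2 + ‖g (N + l + 1)‖ ^ 2) := by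
      refine (pi_norm_le_iff_of_nonneg (Real.sqrt_nonneg _)).2 fun i => Real.le_sqrt_of_sq_le ?_
      fin_cases i <;> simp [hu]
    exact (Real.le_sqrt (norm_nonneg _) (by positivity)).1 h
  refine le_trans ?_ hu2
  have hXα : 0 < X ^ α := Real.rpow_pos_of_pos hX0 α
  have h1 : 1 / D * (X ^ α)⁻¹ ≤ ‖u‖ := by
    rw [one_div, ← mul_inv, inv_le_iff_one_le_mul₀ (by positivity)]
    linarith
  calc (1 / D) ^ 2 * X ^ (-(2 * α)) = (1 / D * (X ^ α)⁻¹) ^ 2 := by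
        rw [mul_pow, ← Real.rpow_neg hX0.le, ← Real.rpow_natCast (X ^ (-α)), ← Real.rpow_mul hX0.le]
        congr 2
        push_cast; ring
    _ ≤ ‖u‖ ^ 2 := by gcongr

end HalfLine
-- Self-adjointness, the evolution and its Laplace transform
namespace HalfLine

open MeasureTheory
open scoped ENNReal

theorem inner_delta (n : ℕ+) (ψ : L2) : inner ℂ (delta n) ψ = ψ n := by
  rw [delta, lp.inner_single_left]
  simp

theorem delta_apply (m n : ℕ+) : (delta m : L2) n = if n = m then 1 else 0 := by
  rw [delta, lp.single_apply]
  split_ifs with h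
  · subst h; simp
  · simp [h]

theorem dirichletExt_coe (ψ : ℕ+ → ℂ) (n : ℕ+) : dirichletExt ψ n = ψ n := by
  simp only [dirichletExt, n.pos, dif_pos]
  rfl

theorem hamiltonian_delta_apply (V : ℕ+ → ℝ) (hV : ∃ C, ∀ n, |V n| ≤ C) (m n : ℕ+) :
    hamiltonian V hV (delta m) n = (if (n : ℕ) = m + 1 then 1 else 0) +
      (if (m : ℕ) = n + 1 then 1 else 0) + if n = m then (V n : ℂ) else 0 := by
  rw [hamiltonian_apply]
  congr 1
  · congr 1
    · by_cases h : n = 1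
      · subst h
        simp [dirichletExt]
      · have h1 : 1 < (n : ℕ) := by
          have := n.pos
          have : (n : ℕ) ≠ 1 := fun h' => h (PNat.coe_eq_one_iff.1 h')
          omega
        rw [dirichletExt, dif_pos (by omega), delta_apply]
        refine if_congr ?_ rfl rfl
        rw [← PNat.coe_inj, Nat.toPNat, PNat.mk_coe]
        omega
    · rw [delta_apply]
      refine if_congr ?_ rfl rfl
      rw [← PNat.coe_inj, PNat.add_coe, PNat.one_coe, eq_comm]
  · rw [delta_apply]; simp

/-- The matrix of `H` in the basis `δ_n` is real and symmetric, so the adjoint agrees with `H` on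
each `δ_n`; pairing with `δ_n` extends this to every `ψ`. -/
theorem isSelfAdjoint_hamiltonian (V : ℕ+ → ℝ) (hV : ∃ C, ∀ n, |V n| ≤ C) :
    IsSelfAdjoint (hamiltonian V hV) := by
  set H := hamiltonian V hV
  have h1 : ∀ n, ContinuousLinearMap.adjoint H (delta n) = H (delta n) := by
    intro n
    ext m
    rw [← inner_delta, ContinuousLinearMap.adjoint_inner_right, ← inner_conj_symm, inner_delta,
      hamiltonian_delta_apply, hamiltonian_delta_apply]
    simp only [map_add, apply_ite (starRingEnd ℂ), map_one, map_zero, Complex.conj_ofReal]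
    rw [add_comm (if (n : ℕ) = m + 1 then (1 : ℂ) else 0)]
    congr 1
    by_cases h : n = m
    · subst h; rfl
    · rw [if_neg h, if_neg (Ne.symm h)]
  refine ContinuousLinearMap.isSelfAdjoint_iff'.2 (ContinuousLinearMap.ext fun ψ => ?_)
  ext n
  rw [← inner_delta, ContinuousLinearMap.adjoint_inner_right, ← h1,
    ContinuousLinearMap.adjoint_inner_left, inner_delta]

theorem norm_evolve_le {H : L2 →L[ℂ] L2} (hH : IsSelfAdjoint H) (ψ : L2) (t : ℝ) :
    ‖evolve H ψ t‖ ≤ ‖ψ‖ := by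
  have hskew : (-(Complex.I * (t : ℂ))) • H ∈ skewAdjoint (L2 →L[ℂ] L2) := by
    rw [skewAdjoint.mem_iff, star_smul, hH.star_eq]
    simp
  let _ : NormedAlgebra ℚ (L2 →L[ℂ] L2) := .restrictScalars ℚ ℂ _
  have hU := NormedSpace.exp_mem_unitary_of_mem_skewAdjoint hskew
  exact (ContinuousLinearMap.norm_map_of_mem_unitary hU ψ).le

theorem hasDerivAt_evolve (H : L2 →L[ℂ] L2) (ψ : L2) (t : ℝ) :
    HasDerivAt (evolve H ψ) ((-Complex.I) • H (evolve H ψ t)) t := by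
  have h := ((ContinuousLinearMap.apply ℂ L2 ψ).restrictScalars ℝ).hasFDerivAt.comp_hasDerivAt t
    (hasDerivAt_exp_smul_const' (𝕂 := ℝ) ((-Complex.I) • H) t)
  have he : ∀ s : ℝ, NormedSpace.exp (s • ((-Complex.I) • H)) ψ = evolve H ψ s := by
    intro s
    rw [evolve, ← smul_assoc]
    congr 3
    rw [Complex.real_smul]; ring
  have hfun : evolve H ψ = fun s : ℝ => NormedSpace.exp (s • ((-Complex.I) • H)) ψ :=
    funext fun s => (he s).symm
  rw [hfun]
  exact h

theorem evolve_zero (H : L2 →L[ℂ] L2) (ψ : L2) : evolve H ψ 0 = ψ := by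
  simp [evolve]

theorem hasDerivAt_evolve_apply (H : L2 →L[ℂ] L2) (ψ : L2) (n : ℕ+) (t : ℝ) :
    HasDerivAt (fun t => evolve H ψ t n) (-Complex.I * H (evolve H ψ t) n) t := by
  have h := ((innerSL ℂ (delta n)).restrictScalars ℝ).hasFDerivAt.comp_hasDerivAt t
    (hasDerivAt_evolve H ψ t)
  have h2 : HasDerivAt (fun t => inner ℂ (delta n) (evolve H ψ t))
    (inner ℂ (delta n) ((-Complex.I) • H (evolve H ψ t))) t := h
  simpa only [inner_smul_right, inner_delta] using h2

/-- The Laplace transform of the `n`-th component of the evolution, which is up to a factor `I`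
the Green function `⟨δ_n, (H - z)⁻¹ ψ⟩`. -/
noncomputable def laplace (H : L2 →L[ℂ] L2) (ψ : L2) (z : ℂ) (n : ℕ+) : ℂ :=
  ∫ t in Set.Ioi (0 : ℝ), Complex.exp (Complex.I * z * t) * evolve H ψ t n

theorem norm_exp_I_mul (z : ℂ) (t : ℝ) :
    ‖Complex.exp (Complex.I * z * t)‖ = Real.exp (-(z.im * t)) := by
  rw [Complex.norm_exp]; simp

theorem norm_evolve_apply_le {H : L2 →L[ℂ] L2} (hH : IsSelfAdjoint H) (ψ : L2) (n : ℕ+) (t : ℝ) :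
    ‖evolve H ψ t n‖ ≤ ‖ψ‖ :=
  (lp.norm_apply_le_norm (by norm_num) _ n).trans (norm_evolve_le hH ψ t)

theorem continuous_evolve_apply (H : L2 →L[ℂ] L2) (ψ : L2) (n : ℕ+) :
    Continuous fun t => evolve H ψ t n :=
  continuous_iff_continuousAt.2 fun t => (hasDerivAt_evolve_apply H ψ n t).continuousAt

theorem integrableOn_laplace {H : L2 →L[ℂ] L2} (hH : IsSelfAdjoint H) (ψ : L2) {z : ℂ}
    (hz : 0 < z.im) (n : ℕ+) :
    IntegrableOn (fun t : ℝ => Complex.exp (Complex.I * z * t) * evolve H ψ t n)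
      (Set.Ioi 0) := by
  refine Integrable.mul_bdd (c := ‖ψ‖)
    (integrableOn_exp_mul_complex_Ioi (a := Complex.I * z) (by simpa using hz) 0)
    (continuous_evolve_apply H ψ n).aestronglyMeasurable
    (Filter.Eventually.of_forall fun t => norm_evolve_apply_le hH ψ n t)

theorem integral_add_add_const_mul {F G K : ℝ → ℂ} {s : Set ℝ} (hF : IntegrableOn F s)
    (hG : IntegrableOn G s) (hK : IntegrableOn K s) (c d : ℂ) :
    ∫ t in s, c * (F t + G t + d * K t) =
      c * ((∫ t in s, F t) + (∫ t in s, G t) + d * ∫ t in s, K t) := by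
  rw [integral_const_mul, integral_add (f := fun t => F t + G t) (hF.add hG) (hK.const_mul d),
    integral_add hF hG, integral_const_mul]

/-- The derivative of `e^{izt} ψ_n(t)` is integrated over the half-line. The boundary term at
infinity vanishes because `Im z > 0`, and the one at `0` gives the source. -/
theorem laplace_eq {V : ℕ+ → ℝ} (hV : ∃ C, ∀ n, |V n| ≤ C) (ψ : L2) {z : ℂ} (hz : 0 < z.im)
    (n : ℕ+) :
    dirichletExt (laplace (hamiltonian V hV) ψ z) ((n : ℕ) - 1) +
        laplace (hamiltonian V hV) ψ z (n + 1) +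
      (V n - z) * laplace (hamiltonian V hV) ψ z n = -Complex.I * ψ n := by
  set H := hamiltonian V hV
  have hH : IsSelfAdjoint H := isSelfAdjoint_hamiltonian V hV
  have hint := fun m => integrableOn_laplace hH ψ hz m
  have hdir : ∃ (F : ℝ → ℂ), IntegrableOn F (Set.Ioi 0) ∧
      (∀ t : ℝ, F t = Complex.exp (Complex.I * z * t) *
        dirichletExt (fun m => evolve H ψ t m) ((n : ℕ) - 1)) ∧
      ∫ t in Set.Ioi (0 : ℝ), F t = dirichletExt (laplace H ψ z) ((n : ℕ) - 1) := by
    refine ⟨_, ?_, fun t => rfl, ?_⟩ <;> by_cases h : 0 < (n : ℕ) - 1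
    · simp only [dirichletExt, dif_pos h]; exact hint _
    · simp only [dirichletExt, dif_neg h, mul_zero]; exact integrableOn_zero
    · simp only [dirichletExt, dif_pos h]; rfl
    · simp only [dirichletExt, dif_neg h, mul_zero, integral_zero]
  obtain ⟨F, hF, hFt, hFi⟩ := hdir
  have hderiv : ∀ t ∈ Set.Ici (0 : ℝ),
      HasDerivAt (fun t : ℝ => Complex.exp (Complex.I * z * t) * evolve H ψ t n)
        (-Complex.I * (F t + Complex.exp (Complex.I * z * t) * evolve H ψ t (n + 1) +
          (V n - z) * (Complex.exp (Complex.I * z * t) * evolve H ψ t n))) t := by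
    intro t _
    have h1 : HasDerivAt (fun t : ℝ => Complex.exp (Complex.I * z * t))
        (Complex.exp (Complex.I * z * t) * (Complex.I * z)) t := by
      have := ((Complex.ofRealCLM.hasDerivAt (x := t)).const_mul (Complex.I * z)).cexp
      simpa using this
    refine (h1.mul (hasDerivAt_evolve_apply H ψ n t)).congr_deriv ?_
    rw [hamiltonian_apply, hFt]
    ring
  have hlim : Filter.Tendsto (fun t : ℝ => Complex.exp (Complex.I * z * t) * evolve H ψ t n)
      Filter.atTop (nhds 0) := by
    refine squeeze_zero_norm (a := fun t : ℝ => Real.exp (-(z.im * t)) * ‖ψ‖) (fun t => ?_) ?_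
    · rw [norm_mul, norm_exp_I_mul]
      gcongr
      exact norm_evolve_apply_le hH ψ n t
    · rw [← zero_mul ‖ψ‖]
      refine Filter.Tendsto.mul_const _ (Real.tendsto_exp_neg_atTop_nhds_zero.comp ?_)
      exact Filter.tendsto_id.const_mul_atTop hz
  have hI := integral_Ioi_of_hasDerivAt_of_tendsto' hderiv
    (((hF.add (hint (n + 1))).add ((hint n).const_mul _)).const_mul _) hlim
  replace hI := (integral_add_add_const_mul hF (hint (n + 1)) (hint n) (-Complex.I)
    (V n - z)).symm.trans hI
  rw [hFi, evolve_zero] at hI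
  simp only [Complex.ofReal_zero, mul_zero, Complex.exp_zero, one_mul, zero_sub] at hI
  change -Complex.I * (dirichletExt (laplace H ψ z) ((n : ℕ) - 1) + laplace H ψ z (n + 1) +
    (V n - z) * laplace H ψ z n) = -ψ n at hI
  linear_combination Complex.I * hI + (dirichletExt (laplace H ψ z) ((n : ℕ) - 1) +
    laplace H ψ z (n + 1) + (V n - z) * laplace H ψ z n) * Complex.I_mul_I

/-- The Green function bounds the time-averaged probabilities from below. -/
theorem laplace_sq_le_avgProb (H : L2 →L[ℂ] L2) (ψ : L2) (E : ℝ) {T : ℝ} (hT : 0 < T) (n : ℕ+) :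
    ENNReal.ofReal (2 / T ^ 2 * ‖laplace H ψ (E + (2 / T : ℝ) * Complex.I) n‖ ^ 2) ≤
      avgProb H ψ n T := by
  set z : ℂ := E + (2 / T : ℝ) * Complex.I with hz
  have him : z.im = 2 / T := by simp [hz]
  -- The choice `Im z = 2/T` makes the damping `e^{-2t/T}`. Half of it goes to `f`, whose square
  -- integrates to `T/2`; the other half, squared in `h`, restores the weight in `avgProb`.
  set f : ℝ → ℝ≥0∞ := fun t => ENNReal.ofReal (Real.exp (-t / T)) with hf
  set h : ℝ → ℝ≥0∞ := fun t => ENNReal.ofReal (Real.exp (-t / T) * ‖evolve H ψ t n‖) with hh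
  have hfm : Measurable f := by fun_prop
  have hhm : Measurable h := by
    have := (continuous_evolve_apply H ψ n).measurable
    fun_prop
  have hf2 : ∫⁻ t in Set.Ioi (0 : ℝ), f t ^ (2 : ℝ) = ENNReal.ofReal (T / 2) := by
    have hneg : -2 / T < 0 := div_neg_of_neg_of_pos (by norm_num) hT
    have h1 : ∀ t, f t ^ (2 : ℝ) = ENNReal.ofReal (Real.exp (-2 / T * t)) := by
      intro t
      rw [hf, ENNReal.ofReal_rpow_of_nonneg (Real.exp_pos _).le (by norm_num), ← Real.exp_mul]
      congr 2; ring
    simp only [h1]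
    rw [← ofReal_integral_eq_lintegral_ofReal (integrableOn_exp_mul_Ioi hneg 0)
      (Filter.Eventually.of_forall fun t => (Real.exp_pos _).le), integral_exp_mul_Ioi hneg]
    congr 1
    rw [mul_zero, Real.exp_zero]
    field_simp
  have hh2 : ∀ t, h t ^ (2 : ℝ) =
      ENNReal.ofReal (Real.exp (-2 * t / T) * ‖inner ℂ (delta n) (evolve H ψ t)‖ ^ 2) := by
    intro t
    rw [hh, ENNReal.ofReal_rpow_of_nonneg (by positivity) (by norm_num), Real.rpow_ofNat, mul_pow,
      ← Real.exp_nat_mul, inner_delta]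
    congr 3; push_cast; ring
  have hCS : ‖laplace H ψ z n‖ₑ ^ 2 ≤
      ENNReal.ofReal (T / 2) * ∫⁻ t in Set.Ioi (0 : ℝ), h t ^ (2 : ℝ) := by
    have h1 : ‖laplace H ψ z n‖ₑ ≤ ∫⁻ t in Set.Ioi (0 : ℝ), (f * h) t := by
      refine (enorm_integral_le_lintegral_enorm _).trans (lintegral_mono fun t => ?_)
      rw [← ofReal_norm, norm_mul, norm_exp_I_mul, Pi.mul_apply, hf, hh,
        ← ENNReal.ofReal_mul (Real.exp_pos _).le, ← mul_assoc, ← Real.exp_add, him]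
      refine ENNReal.ofReal_le_ofReal (le_of_eq ?_)
      congr 2; ring
    have h2 := h1.trans (ENNReal.lintegral_mul_le_Lp_mul_Lq (volume.restrict (Set.Ioi (0 : ℝ)))
      Real.HolderConjugate.two_two hfm.aemeasurable hhm.aemeasurable)
    calc ‖laplace H ψ z n‖ₑ ^ 2 ≤ _ := pow_le_pow_left' h2 2
      _ = _ := by
        rw [mul_pow, ← ENNReal.rpow_natCast, ← ENNReal.rpow_natCast, ← ENNReal.rpow_mul,
          ← ENNReal.rpow_mul, hf2]
        norm_num
  rw [avgProb]
  simp only [← hh2]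
  calc ENNReal.ofReal (2 / T ^ 2 * ‖laplace H ψ z n‖ ^ 2)
      = ENNReal.ofReal (2 / T ^ 2) * ‖laplace H ψ z n‖ₑ ^ 2 := by
        rw [ENNReal.ofReal_mul (by positivity), ENNReal.ofReal_pow (norm_nonneg _),
          ofReal_norm]
    _ ≤ ENNReal.ofReal (2 / T ^ 2) *
        (ENNReal.ofReal (T / 2) * ∫⁻ t in Set.Ioi (0 : ℝ), h t ^ (2 : ℝ)) := by gcongr
    _ = _ := by
        rw [← mul_assoc, ← ENNReal.ofReal_mul (by positivity)]
        congr 2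
        field_simp

end HalfLine
-- From the Green function to moments and growth exponents
namespace HalfLine

open scoped ENNReal

attribute [local instance] Matrix.linftyOpNormedRing Matrix.linftyOpNormedAddCommGroup
  Matrix.linftyOpNormedSpace

/-- The Laplace transform extended to the site `0` so that it solves the homogeneous equation. -/
noncomputable def green (H : L2 →L[ℂ] L2) (z : ℂ) : ℕ → ℂ
  | 0 => Complex.I
  | n + 1 => laplace H (delta 1) z n.succPNat

/-- The value `I` at site `0` absorbs the source `-I` at site `1`, so the homogeneous recursion
holds from the start. -/
theorem green_eq {V : ℕ+ → ℝ} (hV : ∃ C, ∀ n, |V n| ≤ C) {z : ℂ} (hz : 0 < z.im) (n : ℕ) :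
    green (hamiltonian V hV) z n =
      (z - V n.succPNat) * green (hamiltonian V hV) z (n + 1) -
        green (hamiltonian V hV) z (n + 2) := by
  have h := laplace_eq hV (delta 1) hz n.succPNat
  have h2 : n.succPNat + 1 = (n + 1).succPNat := rfl
  rw [h2, delta_apply, Nat.succPNat_coe, Nat.succ_sub_one] at h
  cases n with
  | zero =>
    have h1 : Nat.succPNat 0 = 1 := rfl
    simp only [h1, if_true, dirichletExt, lt_irrefl, dif_neg, not_false_eq_true] at h
    simp only [green, h1]
    linear_combination h
  | succ n =>
    have h1 : (n + 1).succPNat ≠ 1 := fun h => by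
      simpa using congrArg (fun m : ℕ+ => (m : ℕ)) h
    have h3 := dirichletExt_coe (laplace (hamiltonian V hV) (delta 1) z) n.succPNat
    rw [Nat.succPNat_coe, Nat.succ_eq_add_one] at h3
    rw [h3, if_neg h1] at h
    simp only [green]
    linear_combination h

theorem sum_Ico_add_succ_le {F : ℕ → ℝ} (hF : ∀ n, 0 ≤ F n) (M : ℕ) :
    ∑ j ∈ Finset.Ico M (2 * M), (F j + F (j + 1)) ≤ 2 * ∑ j ∈ Finset.Icc M (2 * M), F j := by
  rw [Finset.sum_add_distrib, two_mul (Finset.sum _ _)]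
  refine add_le_add ?_ ?_
  · exact Finset.sum_le_sum_of_subset_of_nonneg
      (fun j hj => by simp only [Finset.mem_Ico, Finset.mem_Icc] at *; omega) fun j _ _ => hF j
  · rw [Finset.sum_Ico_add' F M (2 * M) 1]
    exact Finset.sum_le_sum_of_subset_of_nonneg
      (fun j hj => by simp only [Finset.mem_Ico, Finset.mem_Icc] at *; omega) fun j _ _ => hF j

/-- Only the sites `M + 1, …, 2M + 1` are kept, where `n^p ≥ X^p`. They contain `M` neighbouring
pairs; counting each site at most twice costs the factor `2` of `laplace_sq_le_avgProb`. -/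
theorem le_moment {V : ℕ+ → ℝ} (hV : ∃ C, ∀ n, |V n| ≤ C) (E : ℝ) {p T X S : ℝ} {M : ℕ}
    (hp : 0 ≤ p) (hT : 0 < T) (hX : 0 ≤ X) (hM : X ≤ M)
    (hS : ∀ n ∈ Finset.Ico M (2 * M),
      S ≤ ‖green (hamiltonian V hV) (E + (2 / T : ℝ) * Complex.I) (n + 1)‖ ^ 2 +
        ‖green (hamiltonian V hV) (E + (2 / T : ℝ) * Complex.I) (n + 2)‖ ^ 2) :
    ENNReal.ofReal (X ^ p / T ^ 2 * (M * S)) ≤ moment (hamiltonian V hV) (delta 1) p T := by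
  set H := hamiltonian V hV
  set g := green H (E + (2 / T : ℝ) * Complex.I) with hg
  have hterm : ∀ j ∈ Finset.Icc M (2 * M),
      ENNReal.ofReal (2 * X ^ p / T ^ 2 * ‖g (j + 1)‖ ^ 2) ≤
        ENNReal.ofReal (((j.succPNat : ℕ+) : ℝ) ^ p) * avgProb H (delta 1) j.succPNat T := by
    intro j hj
    have h := laplace_sq_le_avgProb H (delta 1) E hT j.succPNat
    refine le_trans ?_ (mul_le_mul_right h _)
    rw [← ENNReal.ofReal_mul (by positivity)]
    refine ENNReal.ofReal_le_ofReal ?_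
    have hj' : X ≤ ((j.succPNat : ℕ+) : ℝ) := by
      have : (M : ℝ) ≤ j := by exact_mod_cast (Finset.mem_Icc.1 hj).1
      push_cast [Nat.succPNat_coe]
      linarith
    have hgj : g (j + 1) = laplace H (delta 1) (E + (2 / T : ℝ) * Complex.I) j.succPNat := rfl
    rw [hgj]
    calc _ = X ^ p * (2 / T ^ 2 *
          ‖laplace H (delta 1) (E + (2 / T : ℝ) * Complex.I) j.succPNat‖ ^ 2) := by ring
      _ ≤ _ := by gcongr
  have hinj : Function.Injective Nat.succPNat := Nat.succPNat_injective
  calc ENNReal.ofReal (X ^ p / T ^ 2 * (M * S))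
      ≤ ENNReal.ofReal (∑ j ∈ Finset.Icc M (2 * M), 2 * X ^ p / T ^ 2 * ‖g (j + 1)‖ ^ 2) := by
        refine ENNReal.ofReal_le_ofReal ?_
        rw [← Finset.mul_sum]
        have h1 : M * S ≤ 2 * ∑ j ∈ Finset.Icc M (2 * M), ‖g (j + 1)‖ ^ 2 := by
          refine le_trans ?_ (sum_Ico_add_succ_le (F := fun j => ‖g (j + 1)‖ ^ 2)
            (fun _ => by positivity) M)
          have h2 := Finset.card_nsmul_le_sum (Finset.Ico M (2 * M)) _ S hS
          rwa [Nat.card_Ico, two_mul, Nat.add_sub_cancel, nsmul_eq_mul, ← two_mul] at h2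
        calc _ ≤ X ^ p / T ^ 2 * (2 * ∑ j ∈ Finset.Icc M (2 * M), ‖g (j + 1)‖ ^ 2) := by gcongr
          _ = _ := by ring
    _ = ∑ j ∈ Finset.Icc M (2 * M), ENNReal.ofReal (2 * X ^ p / T ^ 2 * ‖g (j + 1)‖ ^ 2) :=
        ENNReal.ofReal_sum_of_nonneg fun _ _ => by positivity
    _ ≤ ∑ j ∈ Finset.Icc M (2 * M),
        ENNReal.ofReal (((j.succPNat : ℕ+) : ℝ) ^ p) * avgProb H (delta 1) j.succPNat T :=
        Finset.sum_le_sum hterm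
    _ = ∑ n ∈ (Finset.Icc M (2 * M)).map ⟨_, hinj⟩,
        ENNReal.ofReal ((n : ℝ) ^ p) * avgProb H (delta 1) n T := by
        rw [Finset.sum_map]; rfl
    _ ≤ _ := ENNReal.sum_le_tsum _

/-- The constant is invisible to the exponent, since `log c / log T → 0`. -/
theorem le_lowerExponent_of_le_moment {H : L2 →L[ℂ] L2} {ψ : L2} {p c γ : ℝ} (hc : 0 < c)
    (h : ∀ᶠ T : ℝ in Filter.atTop, ENNReal.ofReal (c * T ^ γ) ≤ moment H ψ p T) :
    (γ : EReal) ≤ lowerExponent H ψ p := by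
  have hlim : Filter.Tendsto
      (fun T : ℝ => ((Real.log c / Real.log T + γ : ℝ) : EReal)) Filter.atTop (nhds (γ : EReal)) := by
    refine (continuous_coe_real_ereal.tendsto γ).comp ?_
    simpa using (Real.tendsto_log_atTop.const_div_atTop (Real.log c)).add_const γ
  rw [← hlim.liminf_eq, lowerExponent]
  refine Filter.liminf_le_liminf ?_
  filter_upwards [h, Filter.eventually_gt_atTop 1] with T hT hT1
  have hT0 : 0 < T := by linarith
  have hlog : 0 < Real.log T := Real.log_pos hT1
  have h1 : ((Real.log c / Real.log T + γ : ℝ) : EReal) =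
      ENNReal.log (ENNReal.ofReal (c * T ^ γ)) / ((Real.log T : ℝ) : EReal) := by
    rw [ENNReal.log_ofReal_of_pos (by positivity), ← EReal.coe_div,
      Real.log_mul hc.ne' (Real.rpow_pos_of_pos hT0 γ).ne', Real.log_rpow hT0]
    congr 1
    field_simp
  rw [h1]
  exact EReal.monotone_div_right_of_nonneg (by exact_mod_cast hlog.le) (ENNReal.log_monotone hT)

/-- Power-law upper bounds on the transfer matrices at a single energy imply lower bounds on the
growth exponents of the time-averaged moments. -/
theorem le_lowerExponent {V : ℕ+ → ℝ} (hV : ∃ C, ∀ n, |V n| ≤ C) {E C α p : ℝ} {N : ℕ}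
    (hα : 0 ≤ α) (hp : 0 ≤ p) (hC : 0 < C)
    (hprod : ∀ m ≥ N, ∀ l : ℕ,
      ‖orderedProd (fun n => complexTransfer E (V n.succPNat)) m l‖ ≤ C * (1 + l) ^ α) :
    (((p - 1 - 4 * α) / (1 + α) : ℝ) : EReal) ≤ lowerExponent (hamiltonian V hV) (delta 1) p := by
  have hα1 : 0 < 1 + α := by linarith
  obtain ⟨B, hB⟩ := id hV
  obtain ⟨c, hc, h⟩ := exists_le_norm_sq_add_norm_sq (W := fun n => V n.succPNat) hα
    (fun n => hB _) hC hprod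
  refine le_lowerExponent_of_le_moment hc ?_
  filter_upwards [Filter.eventually_ge_atTop 1,
    (tendsto_rpow_atTop (y := 1 / (1 + α)) (by positivity)).eventually_ge_atTop (N : ℝ)]
    with T hT1 hTN
  have hT : 0 < T := by linarith
  -- The largest scale for which the distance `2/T` from `z` to `E` is still `2X^{-(1+α)}`.
  set X := T ^ (1 / (1 + α)) with hXdef
  have hX1 : 1 ≤ X := Real.one_le_rpow hT1 (by positivity)
  have hX0 : 0 < X := by linarith
  have hXT : X ^ (1 + α) = T := by
    rw [hXdef, ← Real.rpow_mul hT.le, one_div_mul_cancel hα1.ne', Real.rpow_one]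
  set M := ⌈X⌉₊ with hMdef
  have hM : X ≤ M := Nat.le_ceil X
  have hM2 : (M : ℝ) ≤ 2 * X := by linarith [Nat.ceil_lt_add_one hX0.le]
  set z : ℂ := E + (2 / T : ℝ) * Complex.I with hz
  have him : 0 < z.im := by simp [hz, hT]
  have hzE : ‖z - E‖ ≤ 2 * X ^ (-(1 + α)) := by
    rw [Real.rpow_neg hX0.le, hXT, hz, add_sub_cancel_left, norm_mul, Complex.norm_I, mul_one,
      Complex.norm_real, Real.norm_eq_abs, abs_of_pos (by positivity), div_eq_mul_inv]
  refine le_trans (ENNReal.ofReal_le_ofReal ?_) (le_moment hV E hp hT hX0.le hM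
    (S := c * X ^ (-(2 * α))) fun n hn => ?_)
  -- Powers of `X`: `p` from the weight, `-2(1+α)` from `T^{-2}`, `1` from the number of pairs,
  -- `-2α` from the solution.
  · have h1 : c * T ^ ((p - 1 - 4 * α) / (1 + α)) =
        X ^ p / T ^ 2 * (X * (c * X ^ (-(2 * α)))) := by
      rw [← hXT, ← Real.rpow_mul hX0.le, ← Real.rpow_natCast (X ^ (1 + α)) 2,
        ← Real.rpow_mul hX0.le, mul_div_cancel₀ _ hα1.ne', div_eq_mul_inv,
        ← Real.rpow_neg hX0.le]
      calc _ = c * (X ^ p * X ^ (-((1 + α) * ((2 : ℕ) : ℝ))) * X ^ (1 : ℝ) * X ^ (-(2 * α))) := by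
            rw [← Real.rpow_add hX0, ← Real.rpow_add hX0, ← Real.rpow_add hX0]
            congr 2
            push_cast; ring
        _ = _ := by rw [Real.rpow_one]; ring
    rw [h1]
    gcongr
  · obtain ⟨hn1, hn2⟩ := Finset.mem_Ico.1 hn
    refine h X hX1 z hzE (green (hamiltonian V hV) z) (by simp [green])
      (green_eq hV him) (n + 1) ?_ ?_
    · have : (N : ℝ) ≤ M := hTN.trans hM
      have : N ≤ M := by exact_mod_cast this
      omega
    · have : ((n + 1 : ℕ) : ℝ) ≤ ((2 * M : ℕ) : ℝ) := by exact_mod_cast hn2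
      push_cast at this ⊢
      linarith

theorem exists_norm_orderedProd_complexTransfer_le {a b E C α : ℝ} {k : ℕ} {V : ℕ+ → ℝ}
    (hk : 0 < k) (hα : 0 ≤ α) (hV : ∀ n, V n = a ∨ V n = b) (hrun : RunsDivisible V a b k)
    (hE : E ∈ goodEnergies b k) (hA : ∀ s : ℕ, ‖complexTransfer E a ^ s‖ ≤ C * (1 + s) ^ α) :
    ∃ N : ℕ, ∃ C' > 0, ∀ m ≥ N, ∀ l : ℕ,
      ‖orderedProd (fun n => complexTransfer E (V n.succPNat)) m l‖ ≤ C' * (1 + l) ^ α := by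
  obtain ⟨N, hN⟩ := hrun
  refine ⟨N, exists_norm_orderedProd_le (complexTransfer E) (W := fun n => V n.succPNat) hα hk
    (fun n => hV _) (complexTransfer_pow_eq hE) (fun n hn l hl h1 h2 h3 => ?_) hA⟩
  refine hN n.succPNat ?_ (l.toPNat hl) h1 ?_ fun j hj => ?_
  · rw [ge_iff_le, ← PNat.coe_le_coe, Nat.succPNat_coe]
    omega
  · have : n.succPNat + l.toPNat hl + 1 = (n + l + 1).succPNat := PNat.eq (by
      change n + 1 + l + 1 = n + l + 1 + 1
      omega)
    rw [this, h2]
  · have hj' : (j : ℕ) ≤ l := by exact_mod_cast hj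
    rw [← h3 j j.pos hj']
    congr 1
    rw [← PNat.coe_inj]
    simp only [PNat.add_coe, Nat.succPNat_coe]
    omega

end HalfLine

theorem theorem4p3 (a b : ℝ) (k : ℕ) (hk : 3 ≤ k) (hodd : Odd k) :
    (HalfLine.goodEnergies b k).ncard = k - 1 ∧
    ∀ (V : ℕ+ → ℝ) (hV : ∀ n, V n = a ∨ V n = b), HalfLine.RunsDivisible V a b k →
      ∀ E ∈ HalfLine.goodEnergies b k,
        (|a - E| < 2 → ∀ p : ℝ, 0 < p →
          ((p - 1 : ℝ) : EReal) ≤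
            HalfLine.lowerExponent
              (HalfLine.hamiltonian V (HalfLine.bounded_of_two_values hV)) (HalfLine.delta 1) p) ∧
        (|a - E| = 2 → ∀ p : ℝ, 0 < p →
          (((p - 5) / 2 : ℝ) : EReal) ≤
            HalfLine.lowerExponent
              (HalfLine.hamiltonian V (HalfLine.bounded_of_two_values hV)) (HalfLine.delta 1) p) := by

  have hk0 : 0 < k := by omega
  refine ⟨HalfLine.ncard_goodEnergies hk0, fun V hV hrun E hE => ⟨fun h p hp => ?_,
    fun h p hp => ?_⟩⟩
  -- The elliptic case is `α = 0`, the parabolic case below is `α = 1`.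
  · obtain ⟨C, hC⟩ := HalfLine.exists_norm_elliptic_pow_le h
    obtain ⟨N, C', hC', hprod⟩ := HalfLine.exists_norm_orderedProd_complexTransfer_le (C := C)
      hk0 le_rfl hV hrun hE (by simpa using hC)
    simpa using HalfLine.le_lowerExponent (HalfLine.bounded_of_two_values hV) le_rfl hp.le hC' hprod
  · obtain ⟨C, hC⟩ := HalfLine.exists_norm_parabolic_pow_le h
    obtain ⟨N, C', hC', hprod⟩ := HalfLine.exists_norm_orderedProd_complexTransfer_le (C := C)
      hk0 zero_le_one hV hrun hE (by simpa using hC)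
    have := HalfLine.le_lowerExponent (HalfLine.bounded_of_two_values hV) zero_le_one hp.le hC'
      hprod
    rwa [show (p - 1 - 4 * 1) / (1 + 1) = (p - 5) / 2 by ring] at this
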